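/- Let $A_1$ be the complex single-mode Weyl algebra, i.e. the associative unital $\mathbb{C}$-algebra generated by $a$ and $a^\dagger$ subject to $aa^\dagger-a^\dagger a=1$, and let $p\mapsto p^\dagger$ be the conjugate-linear involutive anti-automorphism of $A_1$ that exchanges $a$ and $a^\dagger$. Let $\hat{A}_1=\{p\in A_1 : p^\dagger=-p\}$ be the skew-hermitian Weyl algebra, a real Lie algebra under the commutator $[p,q]=pq-qp$. Let $\mathfrak{n}$ be an $n$-dimensional ($n\in\mathbb{N}_{\geq 0}$) nilpotent Lie subalgebra of $\hat{A}_1$. Then either $\mathfrak{n}$ is abelian, or $n\geq 3$ and $\mathfrak{n}$ has a basis $\{y_0,\ldots,y_{n-2},x\}$ such that $$[y_j,y_k]=0\ \ (0\leq j,k\leq n-2),\qquad [x,y_0]=0,\qquad [x,y_j]=y_{j-1}\ \ (1\leq j\leq n-2).$$ In the second case, moreover, $\mathfrak{n}$ is filiform, that is, the terms $\mathfrak{n}_0=\mathfrak{n}$, $\mathfrak{n}_{j+1}=[\mathfrak{n},\mathfrak{n}_j]$ of its lower central series satisfy $\dim\mathfrak{n}_j=n-j-1$ for $1\leq j\leq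 n-1$, and the center of $\mathfrak{n}$ is $i\mathbb{R}$. -/

import Mathlib

/-- The canonical commutation relation `a a† - a† a = 1` imposed on the free complex algebra on two
generators; the generator `0` is the annihilation operator `a`, the generator `1` is the creation
operator `a†`. -/
inductive WeylRel : FreeAlgebra ℂ (Fin 2) → FreeAlgebra ℂ (Fin 2) → Prop
  | ccr : WeylRel
      (FreeAlgebra.ι ℂ (0 : Fin 2) * FreeAlgebra.ι ℂ (1 : Fin 2)
        - FreeAlgebra.ι ℂ (1 : Fin 2) * FreeAlgebra.ι ℂ (0 : Fin 2)) 1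

/-- The complex single-mode Weyl algebra: the associative unital `ℂ`-algebra generated by `a` and
`a†` subject to `[a, a†] = 1`. -/
def WeylAlgebra : Type := RingQuot WeylRel

namespace WeylAlgebra

noncomputable instance : Ring WeylAlgebra := inferInstanceAs (Ring (RingQuot WeylRel))

noncomputable instance : Algebra ℂ WeylAlgebra := inferInstanceAs (Algebra ℂ (RingQuot WeylRel))

/-- The generators: `gen 0 = a` and `gen 1 = a†`. -/
noncomputable def gen (j : Fin 2) : WeylAlgebra :=
  RingQuot.mkAlgHom ℂ WeylRel (FreeAlgebra.ι ℂ j)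

theorem gen_commutator : gen 0 * gen 1 - gen 1 * gen 0 = 1 := by
  have h := RingQuot.mkAlgHom_rel ℂ WeylRel.ccr
  rw [map_sub, map_mul, map_mul, map_one] at h
  exact h

/-- The opposite of the Weyl algebra as a complex algebra, with scalars acting through complex
conjugation. An algebra homomorphism into it is a conjugate-linear anti-homomorphism. -/
@[reducible]
noncomputable def conjOpAlgebra : Algebra ℂ WeylAlgebraᵐᵒᵖ :=
  RingHom.toAlgebra' ((algebraMap ℂ WeylAlgebraᵐᵒᵖ).comp (starRingEnd ℂ))
    (fun c x => Algebra.commutes (starRingEnd ℂ c) x)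

/-- The dagger operation on the free algebra: it exchanges `a` and `a†`. -/
noncomputable def freeDagger :
    letI := conjOpAlgebra
    FreeAlgebra ℂ (Fin 2) →ₐ[ℂ] WeylAlgebraᵐᵒᵖ :=
  letI := conjOpAlgebra
  FreeAlgebra.lift ℂ (fun j : Fin 2 => MulOpposite.op (gen (1 - j)))

theorem freeDagger_rel ⦃p q : FreeAlgebra ℂ (Fin 2)⦄ (h : WeylRel p q) :
    freeDagger p = freeDagger q := by
  let _ := conjOpAlgebra
  cases h
  have h0 : freeDagger (FreeAlgebra.ι ℂ (0 : Fin 2)) = MulOpposite.op (gen 1) :=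
    FreeAlgebra.lift_ι_apply _ _
  have h1 : freeDagger (FreeAlgebra.ι ℂ (1 : Fin 2)) = MulOpposite.op (gen 0) :=
    FreeAlgebra.lift_ι_apply _ _
  rw [map_sub, map_mul, map_mul, map_one, h0, h1, ← MulOpposite.op_mul, ← MulOpposite.op_mul,
    ← MulOpposite.op_sub, gen_commutator, MulOpposite.op_one]

/-- The dagger operation, as a homomorphism into the opposite ring. -/
noncomputable def daggerHom : WeylAlgebra →+* WeylAlgebraᵐᵒᵖ :=
  letI := conjOpAlgebra
  (RingQuot.liftAlgHom ℂ ⟨freeDagger, freeDagger_rel⟩ :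
    RingQuot WeylRel →ₐ[ℂ] WeylAlgebraᵐᵒᵖ).toRingHom

/-- The dagger operation `p ↦ p†`. -/
noncomputable def dagger (p : WeylAlgebra) : WeylAlgebra := (daggerHom p).unop

theorem dagger_gen (j : Fin 2) : dagger (gen j) = gen (1 - j) := by
  let _ := conjOpAlgebra
  have h : daggerHom (gen j) = freeDagger (FreeAlgebra.ι ℂ j) :=
    RingQuot.liftAlgHom_mkAlgHom_apply ℂ freeDagger freeDagger_rel _
  have h2 : freeDagger (FreeAlgebra.ι ℂ j) = MulOpposite.op (gen (1 - j)) :=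
    FreeAlgebra.lift_ι_apply _ _
  rw [dagger, h, h2, MulOpposite.unop_op]

theorem dagger_algebraMap (c : ℂ) :
    dagger (algebraMap ℂ WeylAlgebra c) = algebraMap ℂ WeylAlgebra (starRingEnd ℂ c) := by
  let _ := conjOpAlgebra
  have h : daggerHom (algebraMap ℂ WeylAlgebra c) =
      MulOpposite.op (algebraMap ℂ WeylAlgebra (starRingEnd ℂ c)) :=
    AlgHom.commutes
      (RingQuot.liftAlgHom ℂ ⟨freeDagger, freeDagger_rel⟩ : RingQuot WeylRel →ₐ[ℂ] WeylAlgebraᵐᵒᵖ) c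
  rw [dagger, h, MulOpposite.unop_op]

theorem dagger_add (p q : WeylAlgebra) : dagger (p + q) = dagger p + dagger q := by
  simp [dagger]

theorem dagger_mul (p q : WeylAlgebra) : dagger (p * q) = dagger q * dagger p := by
  simp [dagger]

theorem dagger_dagger (p : WeylAlgebra) : dagger (dagger p) = p := by
  obtain ⟨f, rfl⟩ := RingQuot.mkAlgHom_surjective ℂ WeylRel p
  induction f using FreeAlgebra.induction with
  | grade0 c =>
    have h : RingQuot.mkAlgHom ℂ WeylRel (algebraMap ℂ (FreeAlgebra ℂ (Fin 2)) c)
        = algebraMap ℂ WeylAlgebra c := AlgHom.commutes _ c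
    rw [h, dagger_algebraMap, dagger_algebraMap, Complex.conj_conj]
  | grade1 j =>
    have h : RingQuot.mkAlgHom ℂ WeylRel (FreeAlgebra.ι ℂ j) = gen j := rfl
    rw [h, dagger_gen, dagger_gen, sub_sub_cancel]
  | mul f g hf hg =>
    rw [map_mul]
    refine Eq.trans (congrArg dagger (dagger_mul _ _)) ?_
    rw [dagger_mul, hf, hg]
    rfl
  | add f g hf hg =>
    rw [map_add]
    refine Eq.trans (congrArg dagger (dagger_add _ _)) ?_
    rw [dagger_add, hf, hg]
    rfl

noncomputable instance : StarRing WeylAlgebra where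
  star := dagger
  star_involutive := dagger_dagger
  star_mul := dagger_mul
  star_add := dagger_add

theorem star_gen_zero : star (gen 0) = gen 1 := dagger_gen 0

theorem star_gen_one : star (gen 1) = gen 0 := dagger_gen 1

theorem star_algebraMap (c : ℂ) :
    star (algebraMap ℂ WeylAlgebra c) = algebraMap ℂ WeylAlgebra (starRingEnd ℂ c) :=
  dagger_algebraMap c

instance : StarModule ℂ WeylAlgebra where
  star_smul c p := by
    rw [Algebra.smul_def, star_mul, star_algebraMap, Algebra.smul_def, Algebra.commutes]
    rfl

/-- The commutator bracket. -/
noncomputable instance : LieRing WeylAlgebra := LieRing.ofAssociativeRing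

end WeylAlgebra

/-- The skew-hermitian Weyl algebra: the real Lie algebra of all `p` in the complex Weyl algebra
with `p† = -p`, under the commutator bracket. -/
noncomputable def SkewHermitianWeylAlgebra : LieSubalgebra ℝ WeylAlgebra where
  carrier := {p | star p = -p}
  add_mem' {p q} hp hq := by
    simp only [Set.mem_ofPred_eq] at hp hq ⊢
    rw [star_add, hp, hq, neg_add]
  zero_mem' := by simp
  smul_mem' c p hp := by
    simp only [Set.mem_ofPred_eq] at hp ⊢
    rw [← Complex.coe_smul, star_smul, hp, smul_neg, Complex.star_def, Complex.conj_ofReal]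
  lie_mem' {p q} hp hq := by
    simp only [Set.mem_ofPred_eq] at hp hq
    change star ⁅p, q⁆ = -⁅p, q⁆
    rw [LieRing.of_associative_ring_bracket, star_sub, star_mul, star_mul, hp, hq]
    noncomm_ring

/-- The scalar `i = √-1`, as an element of the skew-hermitian Weyl algebra. -/
noncomputable def scalarI : SkewHermitianWeylAlgebra :=
  ⟨algebraMap ℂ WeylAlgebra Complex.I, by
    change star (algebraMap ℂ WeylAlgebra Complex.I) = -algebraMap ℂ WeylAlgebra Complex.I
    rw [WeylAlgebra.star_algebraMap, Complex.conj_I, map_neg]⟩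

/-- A real Lie algebra of dimension `n` is filiform if the terms `L₀ = L`, `Lⱼ₊₁ = [L, Lⱼ]` of its
lower central series satisfy `dim Lⱼ = n - j - 1` for `1 ≤ j ≤ n - 1`. -/
def IsFiliform (L : Type*) [LieRing L] [LieAlgebra ℝ L] (n : ℕ) : Prop :=
  Module.finrank ℝ L = n ∧
    ∀ j : ℕ, 1 ≤ j → j + 1 ≤ n →
      Module.finrank ℝ (LieModule.lowerCentralSeries ℝ L L j) + j + 1 = n

/-! Everything rests on one property of $A_1$: elements commuting with a common non-scalar element
commute with each other (`mul_comm_of_commute`). Measure $p$ by its order as a polynomial in $a$,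
with coefficients in $\mathbb{C}[a^\dagger]$ on the left. The order is additive on products.
Comparing $pq$ with $qp$ one order below the top shows that leading coefficients $f, g$ of commuting
elements of orders $m, l > 0$ satisfy $m f g' = l g f'$ (`leading_of_commute`). So if $m > 0$, the
centralizer of $p$ has, up to scalars and lower order, at most one element of each order. The orders
attained form a submonoid of $\mathbb{N}$ whose large members are combinations of $m$ and one
further order. Hence the centralizer is $\mathbb{C}[p,q]$ up to finite dimension. Each $r$ in it has
a multiple $f(p)r$, $f \neq 0$, in the commutative algebra $\mathbb{C}[p,q]$, and absence of zero
divisors gives commutativity.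

For nonabelian $\mathfrak{n}$ this forces the center into the scalars; by nilpotency it is nonzero,
so it is $i\mathbb{R}$. Take $y$ noncentral with $[\mathfrak{n},y]$ central. Then $\operatorname{ad}
y$ has rank one, and its kernel $c$ is an abelian ideal of codimension one. For $x \notin c$,
$\operatorname{ad} x$ is nilpotent on $c$ with kernel the center, hence a single Jordan block. The
Jordan chain is the required basis, and the ranks of the powers give the lower central series. -/

namespace WeylAlgebra

/-! ### Normally ordered form of elements of the Weyl algebra -/

open Polynomial

/-- The representation of the Weyl algebra on polynomials, with `a` acting by differentiation and
`a†` by multiplication by the variable. -/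
noncomputable def polynomialRep : WeylAlgebra →ₐ[ℂ] Module.End ℂ ℂ[X] :=
  RingQuot.liftAlgHom ℂ ⟨FreeAlgebra.lift ℂ
    (fun j : Fin 2 => if j = 0 then derivative else LinearMap.mulLeft ℂ (X : ℂ[X])), by
      rintro _ _ ⟨⟩
      refine LinearMap.ext fun f => ?_
      simp [Module.End.mul_apply, derivative_mul]⟩

/-- The representation is needed only for $1 \neq 0$; independence of the normally ordered monomials
then follows by taking commutators with $a$ and $a^\dagger$. -/
instance : Nontrivial WeylAlgebra :=
  polynomialRep.toRingHom.domain_nontrivial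

theorem gen_zero_mul_gen_one : gen 0 * gen 1 = gen 1 * gen 0 + 1 := by
  rw [← gen_commutator]; abel

theorem induction_left {C : WeylAlgebra → Prop} (one : C 1) (add : ∀ p q, C p → C q → C (p + q))
    (smul : ∀ (c : ℂ) p, C p → C (c • p)) (gen_mul : ∀ j p, C p → C (gen j * p)) (p) : C p := by
  suffices h : ∀ q, C q → C (p * q) by simpa using h 1 one
  obtain ⟨f, rfl⟩ := RingQuot.mkAlgHom_surjective ℂ WeylRel p
  induction f using FreeAlgebra.induction with
  | grade0 c =>
    intro q hq
    have h : RingQuot.mkAlgHom ℂ WeylRel (algebraMap ℂ (FreeAlgebra ℂ (Fin 2)) c)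
        = algebraMap ℂ WeylAlgebra c := AlgHom.commutes _ c
    rw [h, ← Algebra.smul_def]
    exact smul c q hq
  | grade1 j => exact fun q hq => gen_mul j q hq
  | mul f g hf hg =>
    intro q hq
    rw [map_mul]
    exact (congrArg C (mul_assoc (G := WeylAlgebra) _ _ q)).mpr (hf _ (hg q hq))
  | add f g hf hg =>
    intro q hq
    rw [map_add]
    exact (congrArg C (add_mul (R := WeylAlgebra) _ _ q)).mpr (add _ _ (hf q hq) (hg q hq))

/-- Polynomials in the creation operator. -/
noncomputable def creationPoly : ℂ[X] →ₐ[ℂ] WeylAlgebra := aeval (gen 1)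

theorem gen_zero_mul_creationPoly (f : ℂ[X]) :
    gen 0 * creationPoly f = creationPoly f * gen 0 + creationPoly (derivative f) := by
  induction f using Polynomial.induction_on' with
  | add f g hf hg => simp only [map_add, mul_add, add_mul, hf, hg]; abel
  | monomial n c =>
    induction n generalizing c with
    | zero => simp [creationPoly, Algebra.commutes]
    | succ n ih =>
      have hX : creationPoly X = gen 1 := aeval_X _
      rw [← monomial_mul_X, map_mul, hX, ← mul_assoc, ih, add_mul, mul_assoc,
        gen_zero_mul_gen_one, mul_add, mul_one, derivative_mul, derivative_X, mul_one, map_add,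
        map_mul, hX, mul_assoc]
      abel

/-- The commutator with $a$ differentiates, so a relation $f(a^\dagger)=0$ gives $f'(a^\dagger)=0$;
descend on the degree to constants. -/
theorem creationPoly_injective : Function.Injective creationPoly := by
  rw [injective_iff_map_eq_zero]
  suffices h : ∀ n : ℕ, ∀ f : ℂ[X], f.natDegree ≤ n → creationPoly f = 0 → f = 0 from
    fun f hf => h _ f le_rfl hf
  intro n
  induction n with
  | zero =>
    intro f hd hf
    rw [Polynomial.eq_C_of_natDegree_le_zero hd] at hf ⊢
    rw [creationPoly, aeval_C, FaithfulSMul.algebraMap_eq_zero_iff] at hf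
    rw [hf, map_zero]
  | succ n ih =>
    intro f hd hf
    have h1 := gen_zero_mul_creationPoly f
    rw [hf, mul_zero, zero_mul, zero_add] at h1
    have h2 := ih (derivative f) ((natDegree_derivative_le f).trans (by omega)) h1.symm
    exact ih f (by rw [derivative_eq_zero.1 h2]; omega) hf

theorem creationPoly_commute (f g : ℂ[X]) :
    creationPoly f * creationPoly g = creationPoly g * creationPoly f := by
  rw [← map_mul, mul_comm, map_mul]

/-- The derivation `p ↦ p a† - a† p`, which differentiates with respect to `a`. -/
noncomputable def delta : WeylAlgebra →ₗ[ℂ] WeylAlgebra :=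
  LinearMap.mulRight ℂ (gen 1) - LinearMap.mulLeft ℂ (gen 1)

theorem delta_apply (p : WeylAlgebra) : delta p = p * gen 1 - gen 1 * p := rfl

theorem delta_mul (p q : WeylAlgebra) : delta (p * q) = delta p * q + p * delta q := by
  simp only [delta_apply]; noncomm_ring

theorem delta_creationPoly (f : ℂ[X]) : delta (creationPoly f) = 0 := by
  have hX : creationPoly X = gen 1 := aeval_X _
  rw [delta_apply, ← hX, creationPoly_commute, sub_self]

theorem delta_gen_zero : delta (gen 0) = 1 := by rw [delta_apply, gen_commutator]

theorem delta_gen_zero_pow (n : ℕ) : delta (gen 0 ^ n) = n • gen 0 ^ (n - 1) := by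
  induction n with
  | zero => simpa using delta_creationPoly 1
  | succ n ih =>
    rw [pow_succ, delta_mul, ih, delta_gen_zero, mul_one, smul_mul_assoc, ← pow_succ]
    rcases n with _ | n
    · simp
    · simp [add_smul]

/-- The element of the Weyl algebra with normally ordered symbol `F`; the inner variable stands for
the creation operator, the outer one for the annihilation operator. -/
noncomputable def normalOrder (F : ℂ[X][X]) : WeylAlgebra :=
  F.eval₂ (creationPoly : ℂ[X] →+* WeylAlgebra) (gen 0)

theorem normalOrder_add (F G : ℂ[X][X]) :
    normalOrder (F + G) = normalOrder F + normalOrder G := eval₂_add _ _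

theorem normalOrder_C (f : ℂ[X]) : normalOrder (C f) = creationPoly f := eval₂_C _ _

theorem normalOrder_monomial (n : ℕ) (f : ℂ[X]) :
    normalOrder (monomial n f) = creationPoly f * gen 0 ^ n := eval₂_monomial _ _

theorem delta_normalOrder (F : ℂ[X][X]) : delta (normalOrder F) = normalOrder (derivative F) := by
  induction F using Polynomial.induction_on' with
  | add F G hF hG => rw [normalOrder_add, map_add, hF, hG, map_add, normalOrder_add]
  | monomial n f =>
    rw [derivative_monomial, normalOrder_monomial, normalOrder_monomial, delta_mul,
      delta_creationPoly, delta_gen_zero_pow, zero_mul, zero_add, map_mul, map_natCast,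
      nsmul_eq_mul, mul_assoc]

/-- Normally ordered elements are stable under left multiplication by the generators, because $a
f(a^\dagger) = f(a^\dagger) a + f'(a^\dagger)$. -/
theorem normalOrder_surjective : Function.Surjective normalOrder := by
  intro p
  induction p using induction_left with
  | one => exact ⟨C 1, by rw [normalOrder_C, map_one]⟩
  | add p q hp hq =>
    obtain ⟨F, rfl⟩ := hp
    obtain ⟨G, rfl⟩ := hq
    exact ⟨F + G, normalOrder_add F G⟩
  | smul c p hp =>
    obtain ⟨F, rfl⟩ := hp
    refine ⟨c • F, ?_⟩
    induction F using Polynomial.induction_on' with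
    | add F G hF hG => rw [smul_add, normalOrder_add, normalOrder_add, hF, hG, smul_add]
    | monomial n f =>
      rw [smul_monomial, normalOrder_monomial, normalOrder_monomial, map_smul, smul_mul_assoc]
  | gen_mul j p hp =>
    obtain ⟨F, rfl⟩ := hp
    fin_cases j
    · change ∃ G, normalOrder G = gen 0 * normalOrder F
      induction F using Polynomial.induction_on' with
      | add F G hF hG =>
        obtain ⟨F', hF⟩ := hF
        obtain ⟨G', hG⟩ := hG
        exact ⟨F' + G', by rw [normalOrder_add, normalOrder_add, hF, hG, mul_add]⟩
      | monomial n f =>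
        refine ⟨monomial (n + 1) f + monomial n (derivative f), ?_⟩
        rw [normalOrder_add, normalOrder_monomial, normalOrder_monomial, normalOrder_monomial,
          ← mul_assoc, gen_zero_mul_creationPoly, add_mul, mul_assoc, pow_succ']
    · change ∃ G, normalOrder G = gen 1 * normalOrder F
      induction F using Polynomial.induction_on' with
      | add F G hF hG =>
        obtain ⟨F', hF⟩ := hF
        obtain ⟨G', hG⟩ := hG
        exact ⟨F' + G', by rw [normalOrder_add, normalOrder_add, hF, hG, mul_add]⟩
      | monomial n f =>
        have hX : creationPoly X = gen 1 := aeval_X _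
        exact ⟨monomial n (X * f), by
          rw [normalOrder_monomial, normalOrder_monomial, map_mul, hX, mul_assoc]⟩

theorem delta_iterate_normalOrder (n : ℕ) (F : ℂ[X][X]) :
    delta^[n] (normalOrder F) = normalOrder (derivative^[n] F) := by
  induction n generalizing F with
  | zero => rfl
  | succ n ih => rw [Function.iterate_succ_apply, delta_normalOrder, ih,
      Function.iterate_succ_apply]

/-- Applying `delta` as often as the degree leaves a factorial times the leading coefficient. -/
theorem normalOrder_eq_zero {F : ℂ[X][X]} (h : normalOrder F = 0) : F = 0 := by
  by_contra hF
  have h1 := delta_iterate_normalOrder F.natDegree F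
  rw [h, iterate_map_zero, eq_C_of_natDegree_eq_zero
    (Nat.le_zero.1 ((natDegree_iterate_derivative F _).trans (Nat.sub_self _).le)),
    normalOrder_C] at h1
  have h2 := creationPoly_injective (h1.symm.trans (map_zero _).symm)
  rw [coeff_iterate_derivative, zero_add, Nat.descFactorial_self, smul_eq_zero] at h2
  exact h2.elim (Nat.factorial_ne_zero _) (by simpa using hF)

theorem exists_creationPoly_of_delta_eq_zero {p : WeylAlgebra} (h : delta p = 0) :
    ∃ f, creationPoly f = p := by
  obtain ⟨F, rfl⟩ := normalOrder_surjective p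
  rw [delta_normalOrder] at h
  have h1 := derivative_eq_zero.1 (normalOrder_eq_zero h)
  refine ⟨F.coeff 0, ?_⟩
  conv_rhs => rw [eq_C_of_natDegree_eq_zero h1, normalOrder_C]

theorem exists_delta_iterate_eq_zero (p : WeylAlgebra) : ∃ n, delta^[n + 1] p = 0 := by
  obtain ⟨F, rfl⟩ := normalOrder_surjective p
  refine ⟨F.natDegree, ?_⟩
  rw [delta_iterate_normalOrder, iterate_derivative_eq_zero (Nat.lt_succ_self _)]
  exact eval₂_zero _ _

end WeylAlgebra

/-! ### Order in the annihilation operator and leading coefficients -/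

namespace WeylAlgebra

open Polynomial Finset

theorem delta_iterate_mul (n : ℕ) (p q : WeylAlgebra) :
    delta^[n] (p * q) =
      ∑ ij ∈ antidiagonal n, n.choose ij.1 • (delta^[ij.1] p * delta^[ij.2] q) := by
  induction n with
  | zero => simp
  | succ n ih =>
    rw [sum_antidiagonal_choose_succ_nsmul (fun i j => delta^[i] p * delta^[j] q) n]
    simp only [Function.iterate_succ_apply', ih, map_sum, map_nsmul, delta_mul, smul_add,
      sum_add_distrib]
    rw [add_comm, add_right_inj]
    refine sum_congr rfl fun ⟨i, j⟩ hij => ?_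
    rw [n.choose_symm_of_eq_add (mem_antidiagonal.1 hij).symm]

theorem delta_iterate_eq_zero_of_le {p : WeylAlgebra} {k l : ℕ} (h : delta^[k] p = 0)
    (hkl : k ≤ l) : delta^[l] p = 0 := by
  rw [← Nat.sub_add_cancel hkl, Function.iterate_add_apply, h, iterate_map_zero]

section Leibniz

variable {p q : WeylAlgebra} {i j : ℕ} (hp : delta^[i + 1] p = 0) (hq : delta^[j + 1] q = 0)
include hp hq

theorem delta_iterate_mul_top :
    delta^[i + j] (p * q) = (i + j).choose i • (delta^[i] p * delta^[j] q) := by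
  rw [delta_iterate_mul, Finset.sum_eq_single (i, j)]
  · rintro ⟨k, l⟩ hkl hne
    rw [HasAntidiagonal.mem_antidiagonal] at hkl
    simp only at hkl
    rcases lt_or_ge i k with h | h
    · simp only [delta_iterate_eq_zero_of_le hp h, zero_mul, smul_zero]
    · have hl : j + 1 ≤ l := by
        have h' : ¬(k = i ∧ l = j) := fun h => hne (by rw [h.1, h.2])
        omega
      simp only [delta_iterate_eq_zero_of_le hq hl, mul_zero, smul_zero]
  · exact fun h => (h (by simp)).elim

theorem delta_iterate_mul_vanish : delta^[i + j + 1] (p * q) = 0 := by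
  rw [delta_iterate_mul]
  refine Finset.sum_eq_zero ?_
  rintro ⟨k, l⟩ hkl
  rw [HasAntidiagonal.mem_antidiagonal] at hkl
  simp only at hkl
  rcases lt_or_ge i k with h | h
  · simp only [delta_iterate_eq_zero_of_le hp h, zero_mul, smul_zero]
  · simp only [delta_iterate_eq_zero_of_le hq (show j + 1 ≤ l by omega), mul_zero, smul_zero]

end Leibniz

/-- The factors have order at most $i+1$ and $j+1$, so this is one below the top, where two terms of
the Leibniz formula survive. -/
theorem delta_iterate_mul_subtop {p q : WeylAlgebra} {i j : ℕ} (hp : delta^[i + 2] p = 0)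
    (hq : delta^[j + 2] q = 0) :
    delta^[i + j + 1] (p * q) = (i + j + 1).choose (i + 1) • (delta^[i + 1] p * delta^[j] q)
      + (i + j + 1).choose i • (delta^[i] p * delta^[j + 1] q) := by
  rw [delta_iterate_mul, ← Finset.sum_subset (s₁ := {(i + 1, j), (i, j + 1)})]
  · rw [Finset.sum_pair (by simp)]
  · intro x hx
    simp only [Finset.mem_insert, Finset.mem_singleton] at hx
    rcases hx with rfl | rfl <;> rw [HasAntidiagonal.mem_antidiagonal] <;> simp only <;> omega
  · rintro ⟨k, l⟩ hkl hne
    rw [HasAntidiagonal.mem_antidiagonal] at hkl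
    simp only at hkl
    simp only [Finset.mem_insert, Finset.mem_singleton, Prod.mk.injEq] at hne
    rcases lt_or_ge (i + 1) k with h | h
    · simp only [delta_iterate_eq_zero_of_le hp h, zero_mul, smul_zero]
    · simp only [delta_iterate_eq_zero_of_le hq (show j + 2 ≤ l by omega), mul_zero, smul_zero]

/-- The order of an element of the Weyl algebra, as a polynomial in the annihilation operator. -/
noncomputable def order (p : WeylAlgebra) : ℕ := sInf {n | delta^[n + 1] p = 0}

theorem delta_iterate_order_succ (p : WeylAlgebra) : delta^[order p + 1] p = 0 :=
  Nat.sInf_mem (exists_delta_iterate_eq_zero p)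

theorem order_lt {p : WeylAlgebra} {k : ℕ} (hp : p ≠ 0) (h : delta^[k] p = 0) : order p < k := by
  rcases k with _ | k
  · exact absurd h hp
  · exact Nat.lt_succ_of_le (Nat.sInf_le h)

theorem order_eq {p : WeylAlgebra} {k : ℕ} (h : delta^[k] p ≠ 0) (h' : delta^[k + 1] p = 0) :
    order p = k := by
  refine le_antisymm (Nat.sInf_le h') (not_lt.1 fun hlt => h ?_)
  exact delta_iterate_eq_zero_of_le (delta_iterate_order_succ p) hlt

theorem exists_leading {p : WeylAlgebra} (hp : p ≠ 0) :
    ∃ f, f ≠ 0 ∧ delta^[order p] p = creationPoly f := by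
  have h := delta_iterate_order_succ p
  rw [Function.iterate_succ_apply'] at h
  obtain ⟨f, hf⟩ := exists_creationPoly_of_delta_eq_zero h
  refine ⟨f, ?_, hf.symm⟩
  rintro rfl
  rw [map_zero] at hf
  exact lt_irrefl _ (order_lt hp hf.symm)

theorem delta_iterate_order_mul {p q : WeylAlgebra} (hp : p ≠ 0) (hq : q ≠ 0) :
    delta^[order p + order q] (p * q) ≠ 0 := by
  obtain ⟨f, hf, hpf⟩ := exists_leading hp
  obtain ⟨g, hg, hqg⟩ := exists_leading hq
  rw [delta_iterate_mul_top (delta_iterate_order_succ p) (delta_iterate_order_succ q), hpf, hqg,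
    ← map_mul, ← map_nsmul, Ne, map_eq_zero_iff _ creationPoly_injective, smul_eq_zero]
  exact not_or.2 ⟨(Nat.choose_pos (Nat.le_add_right _ _)).ne', mul_ne_zero hf hg⟩

instance : NoZeroDivisors WeylAlgebra where
  eq_zero_or_eq_zero_of_mul_eq_zero {p q} h := by
    by_contra! hpq
    exact delta_iterate_order_mul hpq.1 hpq.2 (by rw [h, iterate_map_zero])

theorem order_mul {p q : WeylAlgebra} (hp : p ≠ 0) (hq : q ≠ 0) :
    order (p * q) = order p + order q :=
  order_eq (delta_iterate_order_mul hp hq)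
    (delta_iterate_mul_vanish (delta_iterate_order_succ p) (delta_iterate_order_succ q))

theorem exists_eq_creationPoly_mul_add {g : ℂ[X]} {h : WeylAlgebra} (hg : delta h = creationPoly g) :
    ∃ r, h = creationPoly g * gen 0 + creationPoly r := by
  have h0 : delta (h - creationPoly g * gen 0) = 0 := by
    rw [map_sub, hg, delta_mul, delta_creationPoly, delta_gen_zero, zero_mul, zero_add, mul_one,
      sub_self]
  obtain ⟨r, hr⟩ := exists_creationPoly_of_delta_eq_zero h0
  exact ⟨r, by rw [hr]; abel⟩

theorem creationPoly_mul_sub {f g : ℂ[X]} {h : WeylAlgebra} (hg : delta h = creationPoly g) :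
    h * creationPoly f - creationPoly f * h = creationPoly (g * derivative f) := by
  obtain ⟨r, rfl⟩ := exists_eq_creationPoly_mul_add hg
  rw [add_mul, mul_assoc, gen_zero_mul_creationPoly, mul_add, mul_add, ← mul_assoc, ← mul_assoc,
    creationPoly_commute g f, creationPoly_commute r f, map_mul]
  abel

/-- The top terms of $pq$ and $qp$ always agree, so the information lies one order lower. There
`delta^[i] p` is $fa$ plus a polynomial in $a^\dagger$, so its commutator with $g$ is $fg'$;
symmetrically for $q$. The ratio of the two binomial coefficients is $(i+1):(j+1)$. -/
theorem leading_of_commute {p q : WeylAlgebra} {i j : ℕ} {f g : ℂ[X]} (hpq : p * q = q * p)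
    (hp : delta^[i + 1] p = creationPoly f) (hq : delta^[j + 1] q = creationPoly g) :
    (i + 1) • (f * derivative g) = (j + 1) • (g * derivative f) := by
  have hp' : delta^[i + 2] p = 0 := by
    rw [Function.iterate_succ_apply', hp, delta_creationPoly]
  have hq' : delta^[j + 2] q = 0 := by
    rw [Function.iterate_succ_apply', hq, delta_creationPoly]
  have h1 := delta_iterate_mul_subtop hp' hq'
  have h2 := delta_iterate_mul_subtop hq' hp'
  have hc : (i + j + 1).choose (j + 1) = (i + j + 1).choose i :=
    Nat.choose_symm_of_eq_add (by omega)
  have hd : (i + j + 1).choose j = (i + j + 1).choose (i + 1) :=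
    Nat.choose_symm_of_eq_add (by omega)
  rw [add_comm j i, ← hpq, h1, hc, hd, hp, hq] at h2
  have h3 := creationPoly_mul_sub (f := f) ((Function.iterate_succ_apply' _ _ _).symm.trans hq)
  have h4 := creationPoly_mul_sub (f := g) ((Function.iterate_succ_apply' _ _ _).symm.trans hp)
  have h5 : (i + j + 1).choose i • (f * derivative g)
      = (i + j + 1).choose (i + 1) • (g * derivative f) := by
    apply creationPoly_injective
    rw [map_nsmul, map_nsmul, ← h3, ← h4, smul_sub, smul_sub, sub_eq_sub_iff_add_eq_add,
      add_comm, h2, add_comm]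
  have h6 : (i + j + 1).choose (i + 1) * (i + 1) = (i + j + 1).choose i * (j + 1) := by
    rw [Nat.choose_succ_right_eq, show i + j + 1 - i = j + 1 by omega]
  have h7 : (i + j + 1).choose i • ((i + 1) • (f * derivative g))
      = (i + j + 1).choose i • ((j + 1) • (g * derivative f)) := by
    rw [smul_comm, h5, smul_smul, smul_smul, ← h6, mul_comm]
  exact smul_right_injective _ (Nat.choose_pos (by omega)).ne' h7

end WeylAlgebra

/-! ### Commuting elements of equal order -/

theorem Polynomial.exists_eq_C_mul_of_wronskian_eq_zero {K : Type*} [Field K] [CharZero K]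
    {f g : Polynomial K} (hg : g ≠ 0) (h : f.wronskian g = 0) : ∃ c, f = C c * g := by
  classical
  obtain ⟨f', hf'⟩ := EuclideanDomain.gcd_dvd_left f g
  obtain ⟨g', hg'⟩ := EuclideanDomain.gcd_dvd_right f g
  set d := EuclideanDomain.gcd f g with hd
  have hd0 : d ≠ 0 := by
    rintro h0
    rw [h0, zero_mul] at hg'
    exact hg hg'
  have hco : IsCoprime f' g' := by
    obtain ⟨u, v, huv⟩ : ∃ u v, d = f * u + g * v :=
      ⟨_, _, EuclideanDomain.gcd_eq_gcd_ab f g⟩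
    refine ⟨u, v, mul_left_cancel₀ hd0 ?_⟩
    calc d * (u * f' + v * g') = d * f' * u + d * g' * v := by ring
      _ = d * 1 := by rw [← hf', ← hg', ← huv, mul_one]
  -- A common factor $d$ multiplies the Wronskian by $d^2$. Coprime polynomials with zero Wronskian
  -- have zero derivatives, hence are constant in characteristic zero.
  have hW : d * d * f'.wronskian g' = 0 := by
    rw [← h, hf', hg', wronskian, wronskian, derivative_mul, derivative_mul]
    ring
  have hW' := (mul_eq_zero.1 hW).resolve_left (mul_ne_zero hd0 hd0)
  obtain ⟨h1, h2⟩ := hco.wronskian_eq_zero_iff.1 hW'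
  have e1 := eq_C_of_derivative_eq_zero h1
  have e2 := eq_C_of_derivative_eq_zero h2
  have hb : g'.coeff 0 ≠ 0 := by
    intro hb
    rw [hb, map_zero] at e2
    rw [e2, mul_zero] at hg'
    exact hg hg'
  refine ⟨f'.coeff 0 * (g'.coeff 0)⁻¹, ?_⟩
  rw [hf', hg', e1, e2, coeff_C_zero, coeff_C_zero, mul_left_comm, ← C_mul, mul_assoc,
    inv_mul_cancel₀ hb, mul_one]

namespace WeylAlgebra

open Polynomial

/-- The leading coefficients of $q$ and $r$ solve the same first-order linear equation, so they are
proportional and can be cancelled. -/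
theorem exists_order_sub_smul_lt {p q r : WeylAlgebra} (hp : 0 < order p) (hq : q ≠ 0) (hr : r ≠ 0)
    (hpq : p * q = q * p) (hpr : p * r = r * p) (hqr : order q = order r) :
    ∃ c : ℂ, q - c • r ≠ 0 → order (q - c • r) < order q := by
  have hp0 : p ≠ 0 := by
    rintro rfl
    have h : order 0 = 0 := Nat.le_zero.1 (Nat.sInf_le (map_zero delta))
    omega
  obtain ⟨i, hi⟩ := Nat.exists_eq_add_one_of_ne_zero hp.ne'
  obtain ⟨f, hf, hpf⟩ := exists_leading hp0
  -- `leading_of_commute` needs positive orders, but $q$ and $r$ may have order zero; multiplying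
  -- both by $p$ removes this case.
  obtain ⟨g, hg, hqg⟩ := exists_leading (mul_ne_zero hq hp0)
  obtain ⟨h, hh, hrh⟩ := exists_leading (mul_ne_zero hr hp0)
  rw [order_mul hq hp0, hi, ← add_assoc] at hqg
  rw [order_mul hr hp0, ← hqr, hi, ← add_assoc] at hrh
  rw [hi] at hpf
  have h1 := leading_of_commute (p := p) (q := q * p) (by rw [← mul_assoc, hpq]) hpf hqg
  have h2 := leading_of_commute (p := p) (q := r * p) (by rw [← mul_assoc, hpr]) hpf hrh
  have h3 : (i + 1) • (f * g.wronskian h) = 0 := by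
    calc (i + 1) • (f * g.wronskian h)
        = g * ((i + 1) • (f * derivative h)) - h * ((i + 1) • (f * derivative g)) := by
          simp only [wronskian, nsmul_eq_mul]; ring
      _ = 0 := by rw [h1, h2]; simp only [nsmul_eq_mul]; ring
  have h4 : g.wronskian h = 0 := by
    rw [smul_eq_zero, mul_eq_zero] at h3
    exact (h3.resolve_left (Nat.succ_ne_zero i)).resolve_left hf
  obtain ⟨c, hc⟩ := exists_eq_C_mul_of_wronskian_eq_zero hh h4
  refine ⟨c, fun hne => ?_⟩
  have h5 : delta^[order q + i + 1] ((q - c • r) * p) = 0 := by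
    rw [← Module.End.coe_pow, sub_mul, smul_mul_assoc, map_sub, map_smul, Module.End.coe_pow, hqg,
      hrh, hc, ← smul_eq_C_mul, map_smul, sub_self]
  have h6 := order_lt (mul_ne_zero hne hp0) h5
  rw [order_mul hne hp0] at h6
  omega

/-- Here $p = f(a^\dagger)$ with $f$ nonconstant. An element of positive order commuting with it
would force $g f' = 0$ for its leading coefficient $g$, so the centralizer lies in
$\mathbb{C}[a^\dagger]$. -/
theorem commute_of_order_eq_zero {p q r : WeylAlgebra} (hp : p ∉ Set.range (algebraMap ℂ WeylAlgebra))
    (h0 : order p = 0) (hpq : p * q = q * p) (hpr : p * r = r * p) : q * r = r * q := by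
  have hd := delta_iterate_order_succ p
  rw [h0] at hd
  obtain ⟨f, rfl⟩ := exists_creationPoly_of_delta_eq_zero hd
  have key : ∀ q, creationPoly f * q = q * creationPoly f → ∃ g, creationPoly g = q := by
    intro q hq
    apply exists_creationPoly_of_delta_eq_zero
    by_contra hne
    have hq0 : q ≠ 0 := by
      rintro rfl
      exact hne (map_zero _)
    have hk : order q ≠ 0 := by
      intro h0
      have h1 := delta_iterate_order_succ q
      rw [h0] at h1
      exact hne h1
    obtain ⟨k, hk⟩ := Nat.exists_eq_add_one_of_ne_zero hk
    obtain ⟨g, hg, hqg⟩ := exists_leading hq0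
    rw [hk, Function.iterate_succ_apply'] at hqg
    have h1 := creationPoly_mul_sub (f := f) hqg
    -- Since `delta` is a derivation killing $f(a^\dagger)$, it preserves the centralizer.
    have h2 : ∀ n, delta^[n] q * creationPoly f - creationPoly f * delta^[n] q = 0 := by
      intro n
      induction n with
      | zero => exact sub_eq_zero.2 hq.symm
      | succ n ih =>
        have h3 := congrArg delta ih
        rwa [map_sub, delta_mul, delta_mul, delta_creationPoly, zero_mul, mul_zero, zero_add,
          add_zero, map_zero, ← Function.iterate_succ_apply' delta] at h3
    rw [h2, eq_comm, map_eq_zero_iff _ creationPoly_injective, mul_eq_zero] at h1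
    refine hp ⟨f.coeff 0, ?_⟩
    rw [eq_C_of_derivative_eq_zero (h1.resolve_left hg), coeff_C_zero]
    exact (aeval_C _ _).symm
  obtain ⟨g, rfl⟩ := key q hpq
  obtain ⟨h, rfl⟩ := key r hpr
  exact creationPoly_commute g h

end WeylAlgebra

/-! ### Commutativity of centralizers -/

theorem AddSubmonoid.exists_generator_mod_of_le {m : ℕ} (hm : 0 < m) (V : AddSubmonoid ℕ) :
    ∃ q ∈ V, ∀ r ∈ V, m * q ≤ r → ∃ i j : ℕ, r = i * m + j * q := by
  have : NeZero m := ⟨hm.ne'⟩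
  set W : AddSubmonoid (ZMod m) := V.map (Nat.castAddMonoidHom (ZMod m)) with hW
  -- In a finite group every submonoid is a subgroup, so the image of `V` in `ZMod m` is cyclic; $q$
  -- is a lift of a generator.
  have hcl : (AddSubgroup.closure (W : Set (ZMod m))).toAddSubmonoid = W := by
    rw [AddSubgroup.closure_toAddSubmonoid_of_finite, AddSubmonoid.closure_eq]
  obtain ⟨⟨g, hg⟩, hgen⟩ :=
    IsAddCyclic.exists_generator (α := AddSubgroup.closure (W : Set (ZMod m)))
  obtain ⟨q, hq, hqg⟩ : g ∈ W := hcl ▸ hg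
  refine ⟨q, hq, fun r hr hle => ?_⟩
  have hrW : (r : ZMod m) ∈ AddSubgroup.closure (W : Set (ZMod m)) :=
    AddSubgroup.subset_closure ⟨r, hr, rfl⟩
  have hrg : (r : ZMod m) ∈ AddSubgroup.zmultiples g := by
    obtain ⟨k, hk⟩ := AddSubgroup.mem_zmultiples_iff.1 (hgen ⟨r, hrW⟩)
    exact AddSubgroup.mem_zmultiples_iff.2 ⟨k, congrArg Subtype.val hk⟩
  -- Taking the multiple $k$ below the order of $g$ gives $k \le m$, so $kq \le mq \le r$ and the
  -- difference is a natural multiple of $m$.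
  rw [mem_zmultiples_iff_mem_range_addOrderOf, Finset.mem_image] at hrg
  obtain ⟨k, hk, hkr⟩ := hrg
  have hkm : k ≤ m := (Finset.mem_range.1 hk).le.trans
    ((addOrderOf_le_card_univ).trans_eq (ZMod.card m))
  have hkq : k * q ≤ r := (Nat.mul_le_mul_right q hkm).trans hle
  have hmod : k * q ≡ r [MOD m] := by
    rw [← ZMod.natCast_eq_natCast_iff, ← hkr, ← hqg, Nat.cast_mul, nsmul_eq_mul]
    rfl
  obtain ⟨i, hi⟩ := (Nat.modEq_iff_dvd' hkq).1 hmod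
  exact ⟨i, k, by rw [mul_comm i, ← hi]; omega⟩

section

variable {K A : Type*} [Field K] [Ring A] [Algebra K A] {v : A → ℕ}
  (hv : ∀ {a b : A}, a ≠ 0 → b ≠ 0 → v (a * b) = v a + v b) {p : A}
  (hD : ∀ {q r : A}, q ≠ 0 → r ≠ 0 → p * q = q * p → p * r = r * p → v q = v r →
    ∃ c : K, q - c • r ≠ 0 → v (q - c • r) < v q)
include hv

theorem map_one_of_map_mul_add [Nontrivial A] : v 1 = 0 := by
  have h := hv (one_ne_zero (α := A)) one_ne_zero
  rw [mul_one] at h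
  omega

variable [NoZeroDivisors A]

theorem map_pow_of_map_mul_add [Nontrivial A] {a : A} (ha : a ≠ 0) (n : ℕ) :
    v (a ^ n) = n * v a := by
  induction n with
  | zero => rw [pow_zero, map_one_of_map_mul_add hv, zero_mul]
  | succ n ih => rw [pow_succ, hv (pow_ne_zero n ha) ha, ih, Nat.succ_mul]

include hD

/-- The centralizer of `p` is generated up to a finite-dimensional complement by `p` and one more
element. -/
theorem exists_centralizer_le_adjoin_sup [Nontrivial A] (hp : p ≠ 0) (hvp : 0 < v p) :
    ∃ q, p * q = q * p ∧ ∃ W : Submodule K A, FiniteDimensional K W ∧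
      ∀ r, p * r = r * p → r ∈ (Algebra.adjoin K {p, q}).toSubmodule ⊔ W := by
  classical
  let V : AddSubmonoid ℕ :=
    { carrier := {n | ∃ q, q ≠ 0 ∧ p * q = q * p ∧ v q = n}
      zero_mem' := ⟨1, one_ne_zero, by rw [mul_one, one_mul], map_one_of_map_mul_add hv⟩
      add_mem' := by
        rintro _ _ ⟨q, hq, hpq, rfl⟩ ⟨r, hr, hpr, rfl⟩
        exact ⟨q * r, mul_ne_zero hq hr, by rw [← mul_assoc, hpq, mul_assoc, hpr, mul_assoc],
          hv hq hr⟩ }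
  obtain ⟨_, ⟨q, hq, hpq, rfl⟩, hgen⟩ := V.exists_generator_mod_of_le hvp
  have hex : ∀ n : ℕ, ∃ e : A, n ∈ V → e ≠ 0 ∧ p * e = e * p ∧ v e = n := by
    intro n
    by_cases hn : n ∈ V
    · obtain ⟨e, he⟩ := hn
      exact ⟨e, fun _ => he⟩
    · exact ⟨0, fun h => absurd h hn⟩
  choose e he using hex
  refine ⟨q, hpq, Submodule.span K ((Finset.range (v p * v q)).image e : Finset A),
    FiniteDimensional.span_finset _ _, ?_⟩
  set T := (Algebra.adjoin K {p, q}).toSubmodule ⊔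
    Submodule.span K (((Finset.range (v p * v q)).image e : Finset A) : Set A)
  -- Descent on the value: `T` contains a centralizing element of the same value as $r$, namely some
  -- $p^i q^j$ or, for small values, a chosen `e`. By `hD` a multiple of it lowers the value of $r$.
  suffices h : ∀ n : ℕ, ∀ r, v r = n → r ≠ 0 → p * r = r * p → r ∈ T by
    intro r hr
    by_cases hr0 : r = 0
    · exact hr0 ▸ T.zero_mem
    · exact h _ r rfl hr0 hr
  intro n
  induction n using Nat.strong_induction_on with
  | _ n ih =>
    rintro r rfl hr hpr
    have hrV : v r ∈ V := ⟨r, hr, hpr, rfl⟩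
    obtain ⟨s, hsT, hs, hps, hvs⟩ : ∃ s ∈ T, s ≠ 0 ∧ p * s = s * p ∧ v r = v s := by
      rcases lt_or_ge (v r) (v p * v q) with hlt | hge
      · obtain ⟨h1, h2, h3⟩ := he _ hrV
        refine ⟨e (v r), Submodule.mem_sup_right (Submodule.subset_span ?_), h1, h2, h3.symm⟩
        exact Finset.mem_coe.2 (Finset.mem_image_of_mem e (Finset.mem_range.2 hlt))
      · obtain ⟨i, j, hij⟩ := hgen _ hrV hge
        refine ⟨p ^ i * q ^ j, Submodule.mem_sup_left ?_,
          mul_ne_zero (pow_ne_zero i hp) (pow_ne_zero j hq), ?_, ?_⟩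
        · exact Subalgebra.mul_mem _ (Subalgebra.pow_mem _ (Algebra.subset_adjoin (by simp)) i)
            (Subalgebra.pow_mem _ (Algebra.subset_adjoin (by simp)) j)
        · exact (((Commute.refl p).pow_right i).mul_right (Commute.pow_right hpq j)).eq
        · rw [hv (pow_ne_zero i hp) (pow_ne_zero j hq), map_pow_of_map_mul_add hv hp,
            map_pow_of_map_mul_add hv hq, hij]
    obtain ⟨c, hc⟩ := hD hr hs hpr hps hvs
    have hmem : r - c • s ∈ T := by
      by_cases h0 : r - c • s = 0
      · exact h0 ▸ T.zero_mem
      · refine ih _ (hc h0) _ rfl h0 ?_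
        rw [mul_sub, sub_mul, hpr, mul_smul_comm, smul_mul_assoc, hps]
    rw [← sub_add_cancel r (c • s)]
    exact T.add_mem hmem (T.smul_mem c hsT)

/-- The centralizer of a transcendental element is commutative, if it carries a valuation whose
graded pieces are at most one-dimensional. -/
theorem commute_of_valuation (hp : Transcendental K p) (hvp : 0 < v p) {r s : A}
    (hr : p * r = r * p) (hs : p * s = s * p) : r * s = s * r := by
  have hinj := transcendental_iff_injective.1 hp
  have hp0 : p ≠ 0 := by
    rintro rfl
    exact Polynomial.X_ne_zero (hinj (by simp))
  have : Nontrivial A := ⟨p, 0, hp0⟩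
  obtain ⟨q, hpq, W, hW, hT⟩ := exists_centralizer_le_adjoin_sup hv hD hp0 hvp
  set S := Algebra.adjoin K {p, q} with hS
  have hcomm : ∀ (f : Polynomial K) {r : A}, p * r = r * p →
      Polynomial.aeval p f * r = r * Polynomial.aeval p f := by
    intro f r hr
    induction f using Polynomial.induction_on' with
    | add f g hf hg => rw [map_add, add_mul, mul_add, hf, hg]
    | monomial n c =>
      rw [Polynomial.aeval_monomial]
      exact (Commute.mul_left (Algebra.commutes c r) (Commute.pow_left hr n)).eq
  -- Modulo `S`, all elements $f(p)r$ lie in the image of the finite-dimensional `W`, whereas the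
  -- polynomials $f$ form an infinite-dimensional space.
  have key : ∀ r, p * r = r * p → ∃ f : Polynomial K, f ≠ 0 ∧ Polynomial.aeval p f * r ∈ S := by
    intro r hr
    let φ : Polynomial K →ₗ[K] A ⧸ S.toSubmodule := S.toSubmodule.mkQ ∘ₗ
      LinearMap.mulRight K r ∘ₗ (Polynomial.aeval p).toLinearMap
    have hφ : ∀ f, φ f ∈ W.map S.toSubmodule.mkQ := by
      intro f
      obtain ⟨t, ht, w, hw, htw⟩ := Submodule.mem_sup.1 (hT (Polynomial.aeval p f * r) (by
        rw [mul_assoc, ← hr, ← mul_assoc, ← hcomm f rfl, mul_assoc]))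
      refine ⟨w, hw, ?_⟩
      change _ = S.toSubmodule.mkQ (Polynomial.aeval p f * r)
      rw [← htw, map_add,
        show S.toSubmodule.mkQ t = 0 from (Submodule.Quotient.mk_eq_zero _).2 ht, zero_add]
    have hni : ¬Function.Injective (φ.codRestrict _ hφ) := fun h =>
      Polynomial.not_finite (Module.Finite.of_injective _ h)
    rw [injective_iff_map_eq_zero] at hni
    push Not at hni
    obtain ⟨f, hf, hf0⟩ := hni
    exact ⟨f, hf0, (Submodule.Quotient.mk_eq_zero _).1 (congrArg Subtype.val hf)⟩
  obtain ⟨f, hf, hfr⟩ := key r hr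
  obtain ⟨g, hg, hgs⟩ := key s hs
  have : IsMulCommutative S := Algebra.isMulCommutative_adjoin K (by
    rintro x (rfl | rfl) y (rfl | rfl) <;> simp [hpq])
  have h1 : Polynomial.aeval p f * r * (Polynomial.aeval p g * s)
      = Polynomial.aeval p g * s * (Polynomial.aeval p f * r) :=
    congrArg Subtype.val (mul_comm' (⟨_, hfr⟩ : S) ⟨_, hgs⟩)
  have h2 : Polynomial.aeval p (f * g) * (r * s - s * r) = 0 := by
    rw [map_mul, mul_sub, sub_eq_zero]
    calc Polynomial.aeval p f * Polynomial.aeval p g * (r * s)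
        = Polynomial.aeval p f * r * (Polynomial.aeval p g * s) := by
          rw [mul_assoc, ← mul_assoc (Polynomial.aeval p g) r, hcomm g hr]
          simp only [mul_assoc]
      _ = Polynomial.aeval p g * s * (Polynomial.aeval p f * r) := h1
      _ = Polynomial.aeval p g * Polynomial.aeval p f * (s * r) := by
          rw [mul_assoc, ← mul_assoc s, ← hcomm f hs]
          simp only [mul_assoc]
      _ = _ := by rw [← map_mul, mul_comm g f, map_mul]
  have h3 : Polynomial.aeval p (f * g) ≠ 0 := fun h =>
    mul_ne_zero hf hg (hinj (h.trans (map_zero _).symm))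
  exact sub_eq_zero.1 ((mul_eq_zero.1 h2).resolve_left h3)

end

namespace WeylAlgebra

theorem order_algebraMap (c : ℂ) : order (algebraMap ℂ WeylAlgebra c) = 0 :=
  Nat.le_zero.1 (Nat.sInf_le (by
    change delta (algebraMap ℂ WeylAlgebra c) = 0
    rw [delta_apply, Algebra.commutes, sub_self]))

/-- A polynomial relation over $\mathbb{C}$ splits into linear factors; without zero divisors $p$
would equal a root, a scalar of order zero. -/
theorem transcendental_of_order_pos {p : WeylAlgebra} (hp : 0 < order p) : Transcendental ℂ p := by
  rw [transcendental_iff_injective, injective_iff_map_eq_zero]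
  suffices h : ∀ n : ℕ, ∀ f : Polynomial ℂ, f.natDegree ≤ n → Polynomial.aeval p f = 0 → f = 0 from
    fun f hf => h _ f le_rfl hf
  intro n
  induction n with
  | zero =>
    intro f hd hf
    rw [Polynomial.eq_C_of_natDegree_le_zero hd] at hf ⊢
    rw [Polynomial.aeval_C, FaithfulSMul.algebraMap_eq_zero_iff] at hf
    rw [hf, map_zero]
  | succ n ih =>
    intro f hd hf
    by_cases hdeg : f.degree = 0
    · exact ih f ((Polynomial.natDegree_eq_of_degree_eq_some hdeg).trans_le n.zero_le) hf
    obtain ⟨c, hc⟩ := IsAlgClosed.exists_root f hdeg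
    obtain ⟨g, rfl⟩ := Polynomial.dvd_iff_isRoot.2 hc
    by_cases hg : g = 0
    · rw [hg, mul_zero]
    rw [Polynomial.natDegree_mul (Polynomial.X_sub_C_ne_zero c) hg,
      Polynomial.natDegree_X_sub_C] at hd
    rw [map_mul, mul_eq_zero, map_sub, Polynomial.aeval_X, Polynomial.aeval_C] at hf
    refine absurd (hf.resolve_left fun h => ?_) fun h => hg (ih g (by omega) h)
    rw [sub_eq_zero.1 h, order_algebraMap] at hp
    exact lt_irrefl _ hp

/-- Elements commuting with a non-scalar element of the Weyl algebra commute with each other. -/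
theorem mul_comm_of_commute {p q r : WeylAlgebra} (hp : p ∉ Set.range (algebraMap ℂ WeylAlgebra))
    (hpq : p * q = q * p) (hpr : p * r = r * p) : q * r = r * q := by
  rcases (order p).eq_zero_or_pos with h0 | hpos
  · exact commute_of_order_eq_zero hp h0 hpq hpr
  · exact commute_of_valuation (K := ℂ) order_mul
      (fun hq hr hpq hpr hqr => exists_order_sub_smul_lt hpos hq hr hpq hpr hqr)
      (transcendental_of_order_pos hpos) hpos hpq hpr

end WeylAlgebra

/-! ### Nilpotent endomorphisms with one-dimensional kernel -/

section NilpotentEndomorphism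

variable {K V : Type*} [Field K] [AddCommGroup V] [Module K V] [FiniteDimensional K V]
  {f : Module.End K V} (hf : IsNilpotent f) (hker : Module.finrank K f.ker = 1)
include hf hker

/-- The ranks of the powers of a nilpotent endomorphism with one-dimensional kernel. -/
theorem Module.End.finrank_range_pow_of_isNilpotent (j : ℕ) :
    Module.finrank K (f ^ j).range = Module.finrank K V - j := by
  induction j with
  | zero => rw [pow_zero, Nat.sub_zero]; exact LinearMap.finrank_range_of_inj fun _ _ h => h
  | succ j ih =>
    rw [← Nat.sub_sub, ← ih]
    have hmaps : ∀ v ∈ (f ^ j).range, f v ∈ (f ^ j).range := by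
      rintro _ ⟨v, rfl⟩
      exact ⟨f v, by rw [← Module.End.mul_apply, ← Module.End.mul_apply, ← pow_succ, pow_succ']⟩
    set g : Module.End K (f ^ j).range := f.restrict hmaps with hg
    have hrange : Module.finrank K (f ^ (j + 1)).range = Module.finrank K g.range := by
      have h : (f ^ (j + 1)).range = g.range.map (f ^ j).range.subtype := by
        ext v
        constructor
        · rintro ⟨w, rfl⟩
          exact ⟨_, ⟨⟨_, ⟨w, rfl⟩⟩, rfl⟩, by rw [pow_succ']; rfl⟩
        · rintro ⟨_, ⟨⟨_, ⟨w, rfl⟩⟩, rfl⟩, rfl⟩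
          exact ⟨w, by rw [pow_succ']; rfl⟩
      rw [h, Submodule.finrank_map_subtype_eq]
    -- On a nonzero range the restriction of $f$ has kernel of dimension exactly one: at most one
    -- from $f$, at least one by nilpotency. So each power lowers the rank by one until it is zero.
    have hgker : Module.finrank K g.ker ≤ 1 := by
      rw [← hker, ← Submodule.finrank_map_subtype_eq]
      refine Submodule.finrank_mono ?_
      rintro _ ⟨v, hv, rfl⟩
      exact congrArg Subtype.val hv
    have hrn := g.finrank_range_add_finrank_ker
    rcases Nat.eq_zero_or_pos (Module.finrank K (f ^ j).range) with h0 | hpos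
    · omega
    · have hne : Module.finrank K g.ker ≠ 0 := by
        intro h0
        have := Module.finrank_pos_iff.1 hpos
        obtain ⟨n, hn⟩ : IsNilpotent g := Module.End.isNilpotent.restrict hmaps hf
        have hinj := LinearMap.ker_eq_bot.1 (Submodule.finrank_eq_zero.1 h0)
        obtain ⟨v, hv⟩ := exists_ne (0 : (f ^ j).range)
        have hi := hinj.iterate n
        rw [← Module.End.coe_pow, hn] at hi
        exact hv (hi rfl)
      omega

/-- A nilpotent endomorphism with one-dimensional kernel is a single Jordan block. -/
theorem Module.End.exists_jordan_chain_of_isNilpotent :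
    ∃ b : Fin (Module.finrank K V) → V, LinearIndependent K b ∧
      (∀ j : Fin (Module.finrank K V), (j : ℕ) = 0 → f (b j) = 0) ∧
      ∀ j k : Fin (Module.finrank K V), (k : ℕ) = j + 1 → f (b k) = b j := by
  set d := Module.finrank K V with hd
  have hrk := Module.End.finrank_range_pow_of_isNilpotent hf hker
  have hd1 : 1 ≤ d := hker ▸ Submodule.finrank_le f.ker
  have hfd : ∀ n, d ≤ n → f ^ n = 0 := by
    intro n hn
    rw [← LinearMap.range_eq_bot, ← Submodule.finrank_eq_zero, hrk]
    omega
  have hne : f ^ (d - 1) ≠ 0 := by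
    intro h0
    have h1 := hrk (d - 1)
    rw [h0, LinearMap.range_zero, finrank_bot] at h1
    omega
  obtain ⟨w, hw⟩ : ∃ w, (f ^ (d - 1)) w ≠ 0 := by
    by_contra! h
    exact hne (LinearMap.ext h)
  refine ⟨fun j => (f ^ (d - 1 - j)) w, ?_, ?_, ?_⟩
  · classical
    rw [Fintype.linearIndependent_iff]
    intro c hc
    by_contra! hex
    obtain ⟨i, hi⟩ := hex
    -- Take the largest index with nonzero coefficient: $f^j$ kills all lower vectors of the chain
    -- and sends the $j$th to $f^{d-1}w \neq 0$.
    obtain ⟨j, hj, hmax⟩ := (Finset.univ.filter (fun i => c i ≠ 0)).exists_max_image id ⟨i, by simpa⟩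
    have h1 := congrArg (f ^ (j : ℕ)) hc
    rw [map_zero, map_sum, Finset.sum_eq_single j] at h1
    · rw [map_smul, ← Module.End.mul_apply, ← pow_add,
        show (j : ℕ) + (d - 1 - j) = d - 1 by omega] at h1
      exact (smul_ne_zero (by simpa using hj) hw) h1
    · intro k _ hkj
      rcases lt_or_gt_of_ne hkj with h | h
      · rw [map_smul, ← Module.End.mul_apply, ← pow_add, hfd _ (by omega), LinearMap.zero_apply,
          smul_zero]
      · have hk : c k = 0 := by
          by_contra hk
          exact absurd (hmax k (by simpa using hk)) (not_le.2 h)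
        rw [hk, zero_smul, map_zero]
    · exact fun h => absurd (Finset.mem_univ j) h
  · intro j hj
    simp only
    rw [← Module.End.mul_apply, ← pow_succ', hfd _ (by omega), LinearMap.zero_apply]
  · intro j k hjk
    simp only
    rw [← Module.End.mul_apply, ← pow_succ', show d - 1 - (k : ℕ) + 1 = d - 1 - j by omega]

end NilpotentEndomorphism

/-! ### Nilpotent Lie algebras with abelian centralizers -/

section LieAlgebra

variable {L : Type*} [LieRing L] [LieAlgebra ℝ L]

/-- Take $y$ in the last term of the lower central series not contained in the center; brackets with
it fall into the next term. -/
theorem exists_lie_mem_center_of_not_isLieAbelian [LieRing.IsNilpotent L] (h : ¬IsLieAbelian L) :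
    ∃ y ∉ LieAlgebra.center ℝ L, ∀ u : L, ⁅u, y⁆ ∈ LieAlgebra.center ℝ L := by
  classical
  have hex : ∃ k, LieModule.lowerCentralSeries ℝ L L k ≤ LieAlgebra.center ℝ L := by
    obtain ⟨k, hk⟩ := LieModule.IsNilpotent.nilpotent ℝ L L
    exact ⟨k, hk ▸ bot_le⟩
  have hk := Nat.find_spec hex
  have hmin := fun m => Nat.find_min hex (m := m)
  rcases hk0 : Nat.find hex with _ | k
  · rw [hk0, LieModule.lowerCentralSeries_zero] at hk
    exact absurd ⟨fun u v => hk (LieSubmodule.mem_top v) u⟩ h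
  · rw [hk0] at hk hmin
    obtain ⟨y, hy, hyc⟩ := SetLike.not_le_iff_exists.1 (hmin k k.lt_succ_self)
    refine ⟨y, hyc, fun u => hk ?_⟩
    rw [LieModule.lowerCentralSeries_succ]
    exact LieSubmodule.lie_mem_lie (LieSubmodule.mem_top u) hy

variable {c : Submodule ℝ L} {x : L}

/-- The lower central series of an extension of `ℝ x` by an abelian ideal `c`. -/
theorem lowerCentralSeries_eq_range_ad_pow (hab : ∀ u ∈ c, ∀ v ∈ c, ⁅u, v⁆ = 0)
    (hlie : ∀ u v : L, ⁅u, v⁆ ∈ c) (hx : ∀ u : L, ∃ t : ℝ, ∃ v ∈ c, u = t • x + v) (j : ℕ) :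
    (LieModule.lowerCentralSeries ℝ L L j).toSubmodule = (LieAlgebra.ad ℝ L x ^ j).range := by
  induction j with
  | zero => rw [LieModule.lowerCentralSeries_zero, pow_zero]; exact LinearMap.range_id.symm
  | succ j ih =>
    have hmem : ∀ m, m ∈ LieModule.lowerCentralSeries ℝ L L j ↔
        ∃ v, (LieAlgebra.ad ℝ L x ^ j) v = m := by
      intro m
      rw [← LieSubmodule.mem_toSubmodule, ih]
      rfl
    rw [LieModule.lowerCentralSeries_succ, LieSubmodule.lieIdeal_oper_eq_linear_span']
    refine le_antisymm (Submodule.span_le.2 ?_) ?_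
    · rintro _ ⟨u, -, m, hm, rfl⟩
      obtain ⟨v, rfl⟩ := (hmem m).1 hm
      obtain ⟨t, u', hu', rfl⟩ := hx u
      -- The initial term is not inside `c`, so a bracket with $sx + v'$ has two contributions;
      -- later terms lie in `c` and only $x$ acts on them.
      rcases j with _ | j
      · obtain ⟨s, v', hv', rfl⟩ := hx v
        refine ⟨t • v' - s • u', ?_⟩
        simp only [zero_add, pow_one, pow_zero, Module.End.one_apply, LieAlgebra.ad_apply, lie_sub,
          lie_smul, lie_add, add_lie, smul_lie, lie_self, hab _ hu' _ hv', ← lie_skew x u']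
        module
      · refine ⟨t • v, ?_⟩
        have h1 : ⁅u', (LieAlgebra.ad ℝ L x ^ (j + 1)) v⁆ = 0 := by
          rw [pow_succ', Module.End.mul_apply]
          exact hab _ hu' _ (hlie _ _)
        rw [add_lie, h1, add_zero, pow_succ', Module.End.mul_apply, LieAlgebra.ad_apply, map_smul,
          lie_smul, smul_lie]
    · rintro _ ⟨v, rfl⟩
      rw [pow_succ', Module.End.mul_apply]
      exact Submodule.subset_span ⟨x, LieSubmodule.mem_top x, _, (hmem _).2 ⟨v, rfl⟩, rfl⟩

end LieAlgebra

section

variable {L : Type*} [LieRing L] [LieAlgebra ℝ L]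

theorem LieAlgebra.mem_center_iff_forall_lie_eq_zero {v : L} :
    v ∈ LieAlgebra.center ℝ L ↔ ∀ u : L, ⁅u, v⁆ = 0 :=
  LieModule.mem_maxTrivSubmodule ℝ L L v

variable [FiniteDimensional ℝ L]

/-- `Z` plays the role of the scalars. A central element outside it would have the whole algebra as
an abelian centralizer; nilpotency makes the center nonzero. -/
theorem LieAlgebra.toSubmodule_center_eq_of_centralizer_abelian [LieRing.IsNilpotent L]
    (hab : ¬IsLieAbelian L) {Z : Submodule ℝ L} (hZ : Module.finrank ℝ Z ≤ 1)
    (hcent : ∀ p ∉ Z, ∀ q r : L, ⁅p, q⁆ = 0 → ⁅p, r⁆ = 0 → ⁅q, r⁆ = 0) :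
    (LieAlgebra.center ℝ L).toSubmodule = Z ∧ Module.finrank ℝ (LieAlgebra.center ℝ L) = 1 := by
  have hle : (LieAlgebra.center ℝ L).toSubmodule ≤ Z := by
    intro p hp
    by_contra hpZ
    have h : ∀ u : L, ⁅p, u⁆ = 0 := fun u => by
      rw [← lie_skew, mem_center_iff_forall_lie_eq_zero.1 hp u, neg_zero]
    exact hab ⟨fun q r => hcent p hpZ q r (h q) (h r)⟩
  have hnt : Nontrivial L := by
    by_contra h
    rw [not_nontrivial_iff_subsingleton] at h
    exact hab ⟨fun _ _ => Subsingleton.elim _ _⟩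
  have hnt' : Nontrivial (LieAlgebra.center ℝ L) := LieAlgebra.non_trivial_center_of_isNilpotent
  have hpos : 0 < Module.finrank ℝ (LieAlgebra.center ℝ L) := Module.finrank_pos
  have hmono : Module.finrank ℝ (LieAlgebra.center ℝ L) ≤ Module.finrank ℝ Z :=
    Submodule.finrank_mono hle
  exact ⟨Submodule.eq_of_le_of_finrank_le hle (hZ.trans hpos), by omega⟩

/-- A nilpotent Lie algebra with one-dimensional center, in which the centralizers of noncentral
elements are abelian, has an abelian ideal of codimension one. -/
theorem LieAlgebra.exists_abelian_ideal_of_centralizer_abelian [LieRing.IsNilpotent L]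
    (hab : ¬IsLieAbelian L) (hZ : Module.finrank ℝ (LieAlgebra.center ℝ L) = 1)
    (hcent : ∀ p ∉ LieAlgebra.center ℝ L, ∀ q r : L, ⁅p, q⁆ = 0 → ⁅p, r⁆ = 0 → ⁅q, r⁆ = 0) :
    ∃ (c : Submodule ℝ L) (x : L), x ∉ c ∧ (∀ u ∈ c, ∀ v ∈ c, ⁅u, v⁆ = 0) ∧
      (∀ u v : L, ⁅u, v⁆ ∈ c) ∧ (∀ u : L, ∃ t : ℝ, ∃ v ∈ c, u = t • x + v) ∧
      Module.finrank ℝ c + 1 = Module.finrank ℝ L ∧ (LieAlgebra.center ℝ L).toSubmodule < c := by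
  obtain ⟨y, hy, hyc⟩ := exists_lie_mem_center_of_not_isLieAbelian hab
  have hyc' : ∀ u : L, ⁅y, u⁆ ∈ LieAlgebra.center ℝ L := fun u => by
    rw [← lie_skew]
    exact neg_mem (hyc u)
  obtain ⟨x, hx⟩ : ∃ x : L, ⁅y, x⁆ ≠ 0 := by
    by_contra! h
    exact hy (mem_center_iff_forall_lie_eq_zero.2 fun u => by rw [← lie_skew, h, neg_zero])
  have hsmul : ∀ u : L, ∃ t : ℝ, t • ⁅y, x⁆ = ⁅y, u⁆ := fun u => by
    obtain ⟨t, ht⟩ := (finrank_eq_one_iff_of_nonzero' (⟨_, hyc' x⟩ : LieAlgebra.center ℝ L)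
      fun h => hx (congrArg Subtype.val h)).1 hZ ⟨_, hyc' u⟩
    exact ⟨t, congrArg Subtype.val ht⟩
  have hrange : (LieAlgebra.ad ℝ L y).range = (LieAlgebra.center ℝ L).toSubmodule := by
    apply Submodule.eq_of_le_of_finrank_le
    · rintro _ ⟨u, rfl⟩
      exact hyc' u
    · have hne : Nontrivial (LieAlgebra.ad ℝ L y).range :=
        ⟨⟨_, ⟨x, rfl⟩⟩, 0, fun h => hx (congrArg Subtype.val h)⟩
      have hpos : 0 < Module.finrank ℝ (LieAlgebra.ad ℝ L y).range := Module.finrank_pos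
      exact hZ.le.trans hpos
  refine ⟨(LieAlgebra.ad ℝ L y).ker, x, hx, fun u hu v hv => hcent y hy u v hu hv, ?_, ?_, ?_, ?_⟩
  -- As $[y,u]$ and $[y,v]$ are central, the Leibniz rule puts every bracket into the kernel of
  -- $\operatorname{ad} y$.
  · intro u v
    change ⁅y, ⁅u, v⁆⁆ = 0
    rw [leibniz_lie, ← lie_skew ⁅y, u⁆ v, mem_center_iff_forall_lie_eq_zero.1 (hyc' u),
      mem_center_iff_forall_lie_eq_zero.1 (hyc' v), neg_zero, zero_add]
  · intro u
    obtain ⟨t, ht⟩ := hsmul u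
    refine ⟨t, u - t • x, ?_, (add_sub_cancel _ _).symm⟩
    change ⁅y, u - t • x⁆ = 0
    rw [lie_sub, lie_smul, ht, sub_self]
  · have h := (LieAlgebra.ad ℝ L y).finrank_range_add_finrank_ker
    rw [hrange] at h
    rw [← h, add_comm]
    exact congrArg (· + _) hZ.symm
  · refine lt_of_le_of_ne (fun v hv => mem_center_iff_forall_lie_eq_zero.1 hv y) fun h => hy ?_
    have hmem : y ∈ (LieAlgebra.ad ℝ L y).ker := lie_self y
    rwa [← h] at hmem

/-- Nilpotent nonabelian Lie algebras with one-dimensional center in which the centralizers of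
noncentral elements are abelian are model filiform Lie algebras. -/
theorem LieAlgebra.exists_basis_and_isFiliform_of_centralizer_abelian [LieRing.IsNilpotent L]
    {n : ℕ} (hdim : Module.finrank ℝ L = n)
    (hab : ¬IsLieAbelian L) (hZ : Module.finrank ℝ (LieAlgebra.center ℝ L) = 1)
    (hcent : ∀ p ∉ LieAlgebra.center ℝ L, ∀ q r : L, ⁅p, q⁆ = 0 → ⁅p, r⁆ = 0 → ⁅q, r⁆ = 0) :
    ∃ hn : 3 ≤ n,
      (∃ (y : Fin (n - 1) → L) (x : L),
        (∃ b : Module.Basis (Option (Fin (n - 1))) ℝ L, (∀ j, b (some j) = y j) ∧ b none = x) ∧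
        (∀ j k, ⁅y j, y k⁆ = 0) ∧
        ⁅x, y ⟨0, by omega⟩⁆ = 0 ∧
        (∀ j k : Fin (n - 1), (k : ℕ) = (j : ℕ) + 1 → ⁅x, y k⁆ = y j)) ∧
      IsFiliform L n := by
  obtain ⟨c, x, hxc, habc, hlie, hx, hcdim, hlt⟩ :=
    exists_abelian_ideal_of_centralizer_abelian hab hZ hcent
  have hclt : 1 < Module.finrank ℝ c := by
    rw [← hZ]
    exact Submodule.finrank_lt_finrank_of_lt hlt
  have hmaps : ∀ v ∈ c, LieAlgebra.ad ℝ L x v ∈ c := fun v _ => hlie x v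
  set f : Module.End ℝ c := (LieAlgebra.ad ℝ L x).restrict hmaps with hf
  have hnil : IsNilpotent f :=
    Module.End.isNilpotent.restrict hmaps (LieModule.isNilpotent_toEnd_of_isNilpotent ℝ L L x)
  have hker : Module.finrank ℝ f.ker = 1 := by
    have h : f.ker.map c.subtype = (LieAlgebra.center ℝ L).toSubmodule := by
      ext v
      constructor
      · rintro ⟨v, hv, rfl⟩
        have hv' : ⁅x, (v : L)⁆ = 0 := congrArg Subtype.val hv
        refine mem_center_iff_forall_lie_eq_zero.2 fun u => ?_
        obtain ⟨t, w, hw, rfl⟩ := hx u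
        change ⁅t • x + w, (v : L)⁆ = 0
        rw [add_lie, smul_lie, hv', smul_zero, habc w hw v v.2, zero_add]
      · intro hv
        exact ⟨⟨v, hlt.le hv⟩, Subtype.ext (mem_center_iff_forall_lie_eq_zero.1 hv x), rfl⟩
    rw [← Submodule.finrank_map_subtype_eq, h]
    exact hZ
  have hc : Module.finrank ℝ c = n - 1 := by omega
  refine ⟨by omega, ?_, hdim, ?_⟩
  · have hchain := Module.End.exists_jordan_chain_of_isNilpotent hnil hker
    rw [hc] at hchain
    obtain ⟨b, hb, hb0, hbs⟩ := hchain
    have hli : LinearIndependent ℝ (fun o : Option (Fin (n - 1)) => o.elim x fun j => (b j : L)) := by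
      rw [linearIndependent_option]
      refine ⟨hb.map' c.subtype c.ker_subtype, fun h => hxc (Submodule.span_le.2 ?_ h)⟩
      rintro _ ⟨j, rfl⟩
      exact (b j).2
    refine ⟨fun j => b j, x, ⟨basisOfLinearIndependentOfCardEqFinrank hli ?_, ?_, ?_⟩,
      fun j k => habc _ (b j).2 _ (b k).2, congrArg Subtype.val (hb0 _ rfl),
      fun j k hjk => congrArg Subtype.val (hbs j k hjk)⟩
    · rw [Fintype.card_option, Fintype.card_fin]
      omega
    · intro j
      rw [coe_basisOfLinearIndependentOfCardEqFinrank]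
      rfl
    · rw [coe_basisOfLinearIndependentOfCardEqFinrank]
      rfl
  · intro j hj hjn
    have hpow : ∀ v : c, ((f ^ j) v : L) = (LieAlgebra.ad ℝ L x ^ j) v := fun v => by
      rw [hf, Module.End.pow_restrict]
      rfl
    have h : (LieModule.lowerCentralSeries ℝ L L j).toSubmodule
        = (f ^ j).range.map c.subtype := by
      rw [lowerCentralSeries_eq_range_ad_pow habc hlie hx]
      ext v
      constructor
      · rintro ⟨u, rfl⟩
        obtain ⟨t, w, hw, rfl⟩ := hx u
        refine ⟨_, ⟨⟨w, hw⟩, rfl⟩, ?_⟩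
        -- Since $j \ge 1$, the power kills $x$ and its range is already attained on `c`; this
        -- accounts for dimension $(n-1)-j$.
        have hx0 : (LieAlgebra.ad ℝ L x ^ j) x = 0 := by
          obtain ⟨i, rfl⟩ := Nat.exists_eq_add_one_of_ne_zero (Nat.one_le_iff_ne_zero.1 hj)
          rw [pow_succ, Module.End.mul_apply, LieAlgebra.ad_apply, lie_self, map_zero]
        rw [map_add, map_smul, hx0, smul_zero, zero_add]
        exact hpow _
      · rintro ⟨_, ⟨w, rfl⟩, rfl⟩
        exact ⟨w, (hpow w).symm⟩
    have hfin : Module.finrank ℝ (LieModule.lowerCentralSeries ℝ L L j)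
        = Module.finrank ℝ (f ^ j).range :=
      (congrArg (fun S : Submodule ℝ L => Module.finrank ℝ S) h).trans
        (Submodule.finrank_map_subtype_eq _ _)
    rw [hfin, Module.End.finrank_range_pow_of_isNilpotent hnil hker]
    omega

end

/-! ### Application to the skew-hermitian Weyl algebra -/

theorem SkewHermitianWeylAlgebra.mem_span_scalarI {p : SkewHermitianWeylAlgebra} {z : ℂ}
    (hz : algebraMap ℂ WeylAlgebra z = p) : p ∈ Submodule.span ℝ {scalarI} := by
  have h1 : star (p : WeylAlgebra) = -p := p.2
  rw [← hz, WeylAlgebra.star_algebraMap, ← map_neg] at h1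
  have h2 := FaithfulSMul.algebraMap_injective ℂ WeylAlgebra h1
  have hre : z.re = 0 := by
    have h3 := congrArg Complex.re h2
    rw [Complex.conj_re, Complex.neg_re] at h3
    linarith
  refine Submodule.mem_span_singleton.2 ⟨z.im, Subtype.ext ?_⟩
  rw [← hz]
  change z.im • algebraMap ℂ WeylAlgebra Complex.I = _
  rw [← Complex.coe_smul, Algebra.smul_def, ← map_mul]
  congr 1
  apply Complex.ext <;> simp [hre]

theorem SkewHermitianWeylAlgebra.lie_eq_zero_of_notMem_span_scalarI
    {p q r : SkewHermitianWeylAlgebra} (hp : p ∉ Submodule.span ℝ {scalarI}) (hpq : ⁅p, q⁆ = 0)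
    (hpr : ⁅p, r⁆ = 0) : ⁅q, r⁆ = 0 := by
  have h1 : (p : WeylAlgebra) * q - q * p = 0 := congrArg Subtype.val hpq
  have h2 : (p : WeylAlgebra) * r - r * p = 0 := congrArg Subtype.val hpr
  refine Subtype.ext (sub_eq_zero.2 (WeylAlgebra.mul_comm_of_commute (p := p) ?_
    (sub_eq_zero.1 h1) (sub_eq_zero.1 h2)))
  rintro ⟨z, hz⟩
  exact hp (mem_span_scalarI hz)

theorem mainTheorem6 (𝔫 : LieSubalgebra ℝ SkewHermitianWeylAlgebra) (n : ℕ)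
    [FiniteDimensional ℝ 𝔫] (hdim : Module.finrank ℝ 𝔫 = n) (hnil : LieRing.IsNilpotent 𝔫) :
    IsLieAbelian 𝔫 ∨
      ∃ hn : 3 ≤ n,
        (∃ (y : Fin (n - 1) → 𝔫) (x : 𝔫),
          (∃ b : Module.Basis (Option (Fin (n - 1))) ℝ 𝔫,
            (∀ j, b (some j) = y j) ∧ b none = x) ∧
          (∀ j k, ⁅y j, y k⁆ = 0) ∧
          ⁅x, y ⟨0, by omega⟩⁆ = 0 ∧
          (∀ j k : Fin (n - 1), (k : ℕ) = (j : ℕ) + 1 → ⁅x, y k⁆ = y j)) ∧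
        IsFiliform 𝔫 n ∧
        (LieAlgebra.center ℝ 𝔫).toSubmodule.map 𝔫.toSubmodule.subtype =
          Submodule.span ℝ {scalarI} := by
  refine or_iff_not_imp_left.2 fun hab => ?_
  set Z : Submodule ℝ 𝔫 := (Submodule.span ℝ {scalarI}).comap 𝔫.toSubmodule.subtype with hZdef
  have hcent : ∀ p ∉ Z, ∀ q r : 𝔫, ⁅p, q⁆ = 0 → ⁅p, r⁆ = 0 → ⁅q, r⁆ = 0 :=
    fun p hp q r hpq hpr => Subtype.ext
      (SkewHermitianWeylAlgebra.lie_eq_zero_of_notMem_span_scalarI hp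
        (congrArg Subtype.val hpq) (congrArg Subtype.val hpr))
  have hmap : Z.map 𝔫.toSubmodule.subtype ≤ Submodule.span ℝ {scalarI} :=
    Submodule.map_comap_le _ _
  have hspan : Module.finrank ℝ (Submodule.span ℝ {scalarI}) ≤ 1 :=
    (finrank_span_le_card _).trans (by simp)
  have hZmap : Module.finrank ℝ (Z.map 𝔫.toSubmodule.subtype) = Module.finrank ℝ Z :=
    Submodule.finrank_map_subtype_eq _ _
  have hZ : Module.finrank ℝ Z ≤ 1 := hZmap ▸ (Submodule.finrank_mono hmap).trans hspan
  obtain ⟨hcZ, hc1⟩ := LieAlgebra.toSubmodule_center_eq_of_centralizer_abelian hab hZ hcent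
  obtain ⟨hn, hbasis, hfil⟩ := LieAlgebra.exists_basis_and_isFiliform_of_centralizer_abelian hdim
    hab hc1 fun p hp => hcent p (hcZ ▸ hp)
  refine ⟨hn, hbasis, hfil, ?_⟩
  rw [hcZ]
  -- The center is one-dimensional and lies in the line $i\mathbb{R}$, so it fills it; in particular
  -- $i \in \mathfrak{n}$.
  refine Submodule.eq_of_le_of_finrank_le hmap ?_
  rw [hZmap, ← hcZ]
  exact hspan.trans hc1.ge
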